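/- Conventions. For families $\mathcal A,\mathcal B$ of sets, $\mathsf G_1(\mathcal A,\mathcal B)$ is the game of length $\omega$ in which, in inning $n$, One chooses $A_n\in\mathcal A$ and Two responds with $x_n\in A_n$; Two wins if $\{x_n:n\in\omega\}\in\mathcal B$, and One wins otherwise. $\neg\mathcal B$ denotes the sets not in $\mathcal B$. Consider the four statements: (a) Two has a winning Markov strategy (one depending only on the current move of One and the inning number); (b) Two has a winning (full-information) strategy; (c) One has no winning (full-information) strategy; (d) One has no winning predetermined strategy (one depending only on the inning number). Write $\mathcal G\le_{\mathrm{II}}\mathcal H$ if each of (a)–(d) for $\mathcal G$ implies the same statement for $\mathcal H$, and $\mathcal G\equiv\mathcal H$ if each of (a)–(d) holds for $\mathcal G$ if and only if it holds for $\mathcal H$. Let $X$ be a Hausdorff space. An ideal of closed subsets of $X$ is a family of non-empty closed subsets of $X$ that contains all singletons and is closed under binary unions and under non-empty closed subsets. $X$ is $\mathcal A$-normal if for all $A\in\mathcal A$ and open $U\supseteq A$ there is an open $V$ with $A\subseteq V\subseteq\mathrm{cl}(V)\subseteq U$. $\mathcal O_X(\mathcal B)$ is the set of open covers $\mathscr U$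 of $X$ with $\emptyset,X\notin\mathscr U$ such that each $B\in\mathcal B$ is contained in some $U\in\mathscr U$; $\Lambda_X(\mathcal B)$ is the set of those $\mathscr U\in\mathcal O_X(\mathcal B)$ for which $\{U\in\mathscr U:B\subseteq U\}$ is infinite for each $B\in\mathcal B$. For a space $Y$, $\mathscr T_Y$ is the set of proper non-empty open subsets of $Y$; $\mathscr N_{Y,y}=\{U\in\mathscr T_Y:y\in U\}$; $\mathscr N_Y(A)=\{U\in\mathscr T_Y:A\subseteq U\}$; $\mathscr N_Y[\mathcal A]=\{\mathscr N_Y(A):A\in\mathcal A\}$; $\Omega_{Y,y}=\{S\subseteq Y:y\in\mathrm{cl}(S)\}$; $\mathrm{CD}_Y$ is the set of closed discrete subsets of $Y$. A cusco map $X\to\mathbb R$ is a map $\Phi$ from $X$ to the non-empty compact convex subsets of $\mathbb R$ such that $\{x:\Phi(x)\subseteq V\}$ is open for every open $V\subseteq\mathbb R$; it is minimal if its graph is minimal with respect to inclusion among graphs of cusco maps. $\mathrm{MC}_{\mathcal A}(X)$ is the set $\mathrm{MC}(X)$ of minimal cusco maps $X\to\mathbb R$ with the topology of the uniformity generated by the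 sets of pairs $\langle\Phi,\Psi\rangle$ such that, for all $x\in A$, each of $\Phi(x),\Psi(x)$ is contained in the open $\varepsilon$-neighbourhood of the other, where $A\in\mathcal A$ and $\varepsilon>0$. $\mathbf 0\in\mathrm{MC}(X)$ is the map constantly equal to $\{0\}$. Theorem. Let $\mathcal A$ and $\mathcal B$ be ideals of closed subsets of a Hausdorff space $X$ with $X\notin\mathcal A$ and $X\notin\mathcal B$. If $X$ is $\mathcal A$-normal and every member of $\mathcal B$ is sequentially compact, then \[\mathsf G_1(\mathscr N_X[\mathcal A],\neg\Lambda_X(\mathcal B))\le_{\mathrm{II}}\mathsf G_1(\mathscr T_{\mathrm{MC}_{\mathcal A}(X)},\mathrm{CD}_{\mathrm{MC}_{\mathcal B}(X)}),\] and \begin{align*} \mathsf G_1(\mathscr N_X[\mathcal A],\neg\mathcal O_X(\mathcal B)) &\equiv\mathsf G_1(\mathscr N_{\mathrm{MC}_{\mathcal A}(X),\mathbf 0},\neg\Omega_{\mathrm{MC}_{\mathcal B}(X),\mathbf 0})\\ &\equiv\mathsf G_1(\mathscr T_{\mathrm{MC}_{\mathcal A}(X)},\neg\Omega_{\mathrm{MC}_{\mathcal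 B}(X),\mathbf 0})\\ &\equiv\mathsf G_1(\mathscr T_{\mathrm{MC}_{\mathcal A}(X)},\mathrm{CD}_{\mathrm{MC}_{\mathcal B}(X)}). \end{align*} -/

import Mathlib

open Set Filter Topology

/-! ### Selection games -/

/-- A single-selection game of length `ω`: in each inning One plays a member of `moves`, Two picks
a point of it, and Two wins when the set of all points picked is a member of `target`. -/
structure SelectionGame (α : Type*) where
  moves : Set (Set α)
  target : Set (Set α)

/-- The game `G₁(𝒜, ℬ)`. -/
def G₁ {α : Type*} (𝒜 ℬ : Set (Set α)) : SelectionGame α := ⟨𝒜, ℬ⟩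

namespace SelectionGame

variable {α β : Type*}

/-- One has a winning (full information) strategy. A strategy assigns a legal move to every finite
sequence of points of `⋃ moves`; its values on other sequences are irrelevant. -/
def OneWins (G : SelectionGame α) : Prop :=
  ∃ σ : List α → Set α,
    (∀ s : List α, (∀ x ∈ s, x ∈ ⋃₀ G.moves) → σ s ∈ G.moves) ∧
    ∀ x : ℕ → α, (∀ n, x n ∈ σ (List.ofFn fun k : Fin n => x k)) → range x ∉ G.target

/-- One has a winning predetermined strategy. -/
def OnePreWins (G : SelectionGame α) : Prop :=
  ∃ σ : ℕ → Set α, (∀ n, σ n ∈ G.moves) ∧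
    ∀ x : ℕ → α, (∀ n, x n ∈ σ n) → range x ∉ G.target

/-- Two has a winning (full information) strategy: the answer to the moves `A₀, …, Aₙ` is a legal
selection from `Aₙ`, and the set of all answers is in the target. -/
def TwoWins (G : SelectionGame α) : Prop :=
  ∃ τ : List (Set α) → α, ∀ A : ℕ → Set α, (∀ n, A n ∈ G.moves) →
    (∀ n, τ (List.ofFn fun k : Fin (n + 1) => A k) ∈ A n) ∧
      range (fun n : ℕ => τ (List.ofFn fun k : Fin (n + 1) => A k)) ∈ G.target

/-- Two has a winning Markov strategy: the answer depends only on the latest move of One and on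
the number of the inning. -/
def TwoMarkWins (G : SelectionGame α) : Prop :=
  ∃ τ : Set α → ℕ → α, ∀ A : ℕ → Set α, (∀ n, A n ∈ G.moves) →
    (∀ n, τ (A n) n ∈ A n) ∧ range (fun n => τ (A n) n) ∈ G.target

/-- The preorder `G ≤_II H` on selection games. -/
def LeTwo (G : SelectionGame α) (H : SelectionGame β) : Prop :=
  (G.TwoMarkWins → H.TwoMarkWins) ∧ (G.TwoWins → H.TwoWins) ∧
    (¬ G.OneWins → ¬ H.OneWins) ∧ (¬ G.OnePreWins → ¬ H.OnePreWins)

/-- Equivalence `G ≡ H` of selection games. -/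
def Equivalent (G : SelectionGame α) (H : SelectionGame β) : Prop :=
  (G.TwoMarkWins ↔ H.TwoMarkWins) ∧ (G.TwoWins ↔ H.TwoWins) ∧
    (¬ G.OneWins ↔ ¬ H.OneWins) ∧ (¬ G.OnePreWins ↔ ¬ H.OnePreWins)

end SelectionGame

/-! ### Ideals of closed sets and covers -/

section Covers

variable {X : Type*} [TopologicalSpace X]

/-- An ideal of closed sets: a family of non-empty closed sets, closed under binary unions and
under non-empty closed subsets, that contains all singletons. -/
structure IsIdealOfClosedSets (𝒜 : Set (Set X)) : Prop where
  nonempty : ∀ A ∈ 𝒜, A.Nonempty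
  isClosed : ∀ A ∈ 𝒜, IsClosed A
  union_mem : ∀ A ∈ 𝒜, ∀ B ∈ 𝒜, A ∪ B ∈ 𝒜
  mem_of_subset : ∀ A ∈ 𝒜, ∀ B ⊆ A, IsClosed B → B.Nonempty → B ∈ 𝒜
  singleton_mem : ∀ x, {x} ∈ 𝒜

/-- `X` is `𝒜`-normal. -/
def IdealNormal (𝒜 : Set (Set X)) : Prop :=
  ∀ A ∈ 𝒜, ∀ U : Set X, IsOpen U → A ⊆ U →
    ∃ V : Set X, IsOpen V ∧ A ⊆ V ∧ closure V ⊆ U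

/-- `𝒪_X(𝒜)`: the non-trivial open covers `𝒰` of `X` such that every member of `𝒜` is contained
in a member of `𝒰`. -/
def idealCovers (𝒜 : Set (Set X)) : Set (Set (Set X)) :=
  {𝒰 | (∀ U ∈ 𝒰, IsOpen U) ∧ ⋃₀ 𝒰 = univ ∧ ∅ ∉ 𝒰 ∧ univ ∉ 𝒰 ∧
    ∀ A ∈ 𝒜, ∃ U ∈ 𝒰, A ⊆ U}

/-- `Λ_X(𝒜)`: the `𝒜`-covers for which every member of `𝒜` is contained in infinitely many
members of the cover. -/
def largeIdealCovers (𝒜 : Set (Set X)) : Set (Set (Set X)) :=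
  {𝒰 | 𝒰 ∈ idealCovers 𝒜 ∧ ∀ A ∈ 𝒜, {U ∈ 𝒰 | A ⊆ U}.Infinite}

end Covers

/-! ### Families attached to a topology

The topology is an explicit argument, since two topologies on one set have to be compared. -/

section Families

variable {Y : Type*} (t : TopologicalSpace Y)

/-- `𝒯_Y`: the proper non-empty open sets. -/
def properOpens : Set (Set Y) := {U | IsOpen[t] U ∧ U.Nonempty ∧ U ≠ univ}

/-- `𝒩_{Y,y}`: the proper open sets that contain `y`. -/
def properNhds (y : Y) : Set (Set Y) := {U | U ∈ properOpens t ∧ y ∈ U}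

/-- `𝒩_Y(A)`: the proper non-empty open sets that contain `A`. -/
def setNhds (A : Set Y) : Set (Set Y) := {U | U ∈ properOpens t ∧ A ⊆ U}

/-- `𝒩_Y[𝒜] = {𝒩_Y(A) : A ∈ 𝒜}`. -/
def nhdFamilies (𝒜 : Set (Set Y)) : Set (Set (Set Y)) := setNhds t '' 𝒜

/-- `Ω_{Y,y}`: the sets with `y` in their closure. -/
def clusterSets (y : Y) : Set (Set Y) := {S | y ∈ @closure Y t S}

/-- `CD_Y`: the closed discrete sets. -/
def closedDiscreteSets : Set (Set Y) := {S | IsClosed[t] S ∧ @IsDiscrete Y t S}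

end Families

/-! ### Minimal cusco maps -/

section Cusco

variable {X Y : Type*} [TopologicalSpace X] [TopologicalSpace Y]

/-- Mathlib's upper hemicontinuity is the upper semicontinuity of set-valued maps: the set
`{x | Φ x ⊆ V}` is open for every open `V`. -/
theorem upperHemicontinuous_iff_isOpen_setOf_subset (Φ : X → Set Y) :
    UpperHemicontinuous Φ ↔ ∀ V : Set Y, IsOpen V → IsOpen {x | Φ x ⊆ V} := by
  constructor
  · intro h V hV
    rw [isOpen_iff_mem_nhds]
    intro x hx
    filter_upwards [h x V (hV.mem_nhdsSet.2 hx)] with z hz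
    exact hV.mem_nhdsSet.1 hz
  · intro h x t ht
    obtain ⟨V, hV, hxV, hVt⟩ := mem_nhdsSet_iff_exists.1 ht
    filter_upwards [(h V hV).mem_nhds hxV] with z hz
    exact mem_nhdsSet_iff_exists.2 ⟨V, hV, hz, hVt⟩

/-- Usco maps: upper semicontinuous maps with non-empty compact values. -/
structure IsUsco (Φ : X → Set Y) : Prop where
  upperHemicontinuous : UpperHemicontinuous Φ
  nonempty : ∀ x, (Φ x).Nonempty
  isCompact : ∀ x, IsCompact (Φ x)

/-- Cusco maps: convex-valued usco maps. -/
structure IsCusco [AddCommGroup Y] [Module ℝ Y] (Φ : X → Set Y) : Prop extends IsUsco Φ where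
  convex : ∀ x, Convex ℝ (Φ x)

end Cusco

/-- `MC(X)`: the minimal cusco maps from `X` to `ℝ`. The pointwise order on `X → Set ℝ` is the
inclusion of graphs. -/
def MC (X : Type*) [TopologicalSpace X] : Type _ :=
  {Φ : X → Set ℝ // Minimal (fun Ψ : X → Set ℝ => IsCusco Ψ) Φ}

namespace MC

variable {X : Type*} [TopologicalSpace X]

/-- The map that is constantly `{0}`. -/
def zero : MC X :=
  ⟨fun _ => {0},
    { upperHemicontinuous := UpperHemicontinuous.const
      nonempty := fun _ => singleton_nonempty 0
      isCompact := fun _ => isCompact_singleton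
      convex := fun _ => convex_singleton 0 },
    fun Ψ hΨ hle x => by
      obtain ⟨y, hy⟩ := hΨ.nonempty x
      have h0 : y = 0 := hle x hy
      subst h0
      exact singleton_subset_iff.2 hy⟩

/-- `𝐖(A, ε)`: the pairs of maps whose values at every point of `A` lie in the open
`ε`-neighbourhoods of each other. -/
def W (A : Set X) (ε : ℝ) : Set (MC X × MC X) :=
  {p | ∀ x ∈ A, p.1.1 x ⊆ Metric.thickening ε (p.2.1 x) ∧
    p.2.1 x ⊆ Metric.thickening ε (p.1.1 x)}

/-- The uniformity generated by the sets `𝐖(A, ε)` with `A ∈ 𝒜` and `ε > 0`. -/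
def uniformCore (𝒜 : Set (Set X)) : UniformSpace.Core (MC X) where
  uniformity := ⨅ A ∈ 𝒜, ⨅ ε : ℝ, ⨅ _ : 0 < ε, 𝓟 (W A ε)
  refl := by
    simp only [le_iInf_iff, le_principal_iff, mem_principal]
    rintro A - ε hε ⟨Φ, Ψ⟩ h
    obtain rfl : Φ = Ψ := h
    exact fun x _ => ⟨Metric.self_subset_thickening hε _, Metric.self_subset_thickening hε _⟩
  symm := by
    simp only [tendsto_iInf, tendsto_principal]
    intro A hA ε hε
    refine mem_iInf_of_mem A <| mem_iInf_of_mem hA <| mem_iInf_of_mem ε <|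
      mem_iInf_of_mem hε <| mem_principal.2 fun p hp x hx => ⟨(hp x hx).2, (hp x hx).1⟩
  comp := by
    simp only [le_iInf_iff, le_principal_iff]
    intro A hA ε hε
    have hmem : W A (ε / 2) ∈ (⨅ A ∈ 𝒜, ⨅ ε : ℝ, ⨅ _ : 0 < ε, 𝓟 (W A ε)) :=
      mem_iInf_of_mem A <| mem_iInf_of_mem hA <| mem_iInf_of_mem (ε / 2) <|
        mem_iInf_of_mem (half_pos hε) <| mem_principal_self _
    refine mem_of_superset (mem_lift' hmem) ?_
    rintro ⟨Φ, Ψ⟩ ⟨Θ, h₁, h₂⟩ x hx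
    have key : ∀ S T R : Set ℝ, S ⊆ Metric.thickening (ε / 2) T →
        T ⊆ Metric.thickening (ε / 2) R → S ⊆ Metric.thickening ε R := by
      intro S T R hST hTR s hs
      obtain ⟨y, hy, hsy⟩ := Metric.mem_thickening_iff.1 (hST hs)
      obtain ⟨z, hz, hyz⟩ := Metric.mem_thickening_iff.1 (hTR hy)
      exact Metric.mem_thickening_iff.2
        ⟨z, hz, by linarith [dist_triangle s y z]⟩
    exact ⟨key _ _ _ (h₁ x hx).1 (h₂ x hx).1, key _ _ _ (h₂ x hx).2 (h₁ x hx).2⟩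

/-- The topology of `MC_𝒜(X)`, that is, uniform convergence on the members of `𝒜`. -/
abbrev topology (𝒜 : Set (Set X)) : TopologicalSpace (MC X) :=
  (uniformCore 𝒜).toTopologicalSpace

/-- For an ideal `𝒜` of closed subsets of a non-empty space the sets `𝐖(A, ε)` are a base of the
uniformity, so that a set is open exactly when it contains some `[Φ; A, ε]` for each of its
members `Φ`. -/
theorem isOpen_topology_iff [Nonempty X] {𝒜 : Set (Set X)} (h𝒜 : IsIdealOfClosedSets 𝒜)
    (S : Set (MC X)) :
    IsOpen[topology 𝒜] S ↔
      ∀ Φ ∈ S, ∃ A ∈ 𝒜, ∃ ε > 0, {Ψ : MC X | (Φ, Ψ) ∈ W A ε} ⊆ S := by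
  have hb : (uniformCore 𝒜).uniformity.HasBasis
      (fun i : Set X × ℝ => i.1 ∈ 𝒜 ∧ 0 < i.2) fun i => W i.1 i.2 := by
    have he : (uniformCore 𝒜).uniformity =
        ⨅ (i : Set X × ℝ) (_ : i.1 ∈ 𝒜 ∧ 0 < i.2), 𝓟 (W i.1 i.2) := by
      simp only [uniformCore, iInf_prod, iInf_and]
      exact iInf_congr fun A => iInf_comm
    rw [he]
    refine hasBasis_biInf_principal' ?_ ⟨({Classical.arbitrary X}, 1), h𝒜.singleton_mem _, one_pos⟩
    rintro ⟨A, ε⟩ ⟨hA, hε⟩ ⟨B, δ⟩ ⟨hB, hδ⟩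
    have mono : ∀ (C : Set X) (η : ℝ), C ⊆ A ∪ B → min ε δ ≤ η → W (A ∪ B) (min ε δ) ⊆ W (A ∪ B) η :=
      fun C η _ hη p hp x hx => ⟨(hp x hx).1.trans (Metric.thickening_mono hη _),
        (hp x hx).2.trans (Metric.thickening_mono hη _)⟩
    exact ⟨(A ∪ B, min ε δ), ⟨h𝒜.union_mem A hA B hB, lt_min hε hδ⟩,
      fun p hp x hx => mono A ε subset_union_left (min_le_left _ _) hp x (Or.inl hx),
      fun p hp x hx => mono B δ subset_union_right (min_le_right _ _) hp x (Or.inr hx)⟩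
  have hn : ∀ Φ : MC X, @nhds _ (topology 𝒜) Φ =
      comap (Prod.mk Φ) (uniformCore 𝒜).uniformity := (uniformCore 𝒜).nhds_toTopologicalSpace
  refine (letI := topology 𝒜; isOpen_iff_mem_nhds (s := S)).trans ?_
  refine forall₂_congr fun Φ _ => ?_
  rw [hn, (hb.comap _).mem_iff]
  constructor
  · rintro ⟨⟨A, ε⟩, ⟨hA, hε⟩, h⟩
    exact ⟨A, hA, ε, hε, h⟩
  · rintro ⟨A, hA, ε, hε, h⟩
    exact ⟨(A, ε), ⟨hA, hε⟩, h⟩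

end MC

/-!
Two plays in the game `H` with the help of a game `G` by replacing each move of One in `H` by a move
in `G` and turning the answer of Two in `G` into an answer in `H`. If this respects the winning
conditions, `G ≤_II H` follows for all four kinds of strategies at once (`LeTwo.of_relation`). The
theorem is obtained from a diagram of such comparisons between the covering game on `X` and the
games on `MC(X)`.

* From the covering game to both games on `𝒯_{MC_𝒜(X)}` (`coverGame_leTwo_properOpens`): an open set
  contains some `[Φ; A, ε]`, and a neighbourhood `U` of `A` yields a minimal cusco map that agrees
  with `Φ` on `A` and is constantly `n + 1` off `U`, where `n` is the number of the inning
  (`MC.exists_eqOn_eqOn_compl`). For this, `𝒜`-normality gives an open `V` between `A` and `U`; a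
  minimal cusco map is chosen below the cusco map that is `Φ` on `V`, constant off the closure of
  `V` and a convex hull in between, and by minimality of `Φ` it agrees with `Φ` on `V`. If
  some `B ∈ ℬ` lies in none of the sets `U`, these maps are large on `B`. So they stay away from
  `0`, and since cusco maps are bounded on sequentially compact sets, they form a closed discrete
  set (`MC.range_mem_closedDiscreteSets`).
* From either game on `𝒯_{MC_𝒜(X)}` to the game on the neighbourhoods of `0`: for non-accumulation at
  `0` One merely has fewer moves; for closed discrete sets `0` is removed from the neighbourhoods
  (`closedDiscrete_leTwo_properNhds`).
* From the game at `0` back to the covering game (`properNhds_leTwo_coverGame`): a map `Φ` close to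
  `0` on `A` yields the neighbourhood `{x | Φ x ⊆ (-1/(n+1), 1/(n+1))}` of `A`.

Since ideals can absorb finitely many points, every ideal cover is large
(`IsIdealOfClosedSets.largeIdealCovers_eq`), so the first comparison is part of the diagram.
-/

/-! ### Translation of strategies -/

namespace SelectionGame

variable {α β : Type*}

/-- A game `H` is at least as favourable to Two as `G` as soon as each move `B` of One in `H` can
be replaced by a move `A` of One in `G` such that any answer to `A` can be turned into an answer to
`B`, and such that this turns plays of `G` won by Two into plays of `H` won by Two. The relation
`R n x y` records what has to be known about the answer `y` in `H` that is made from the answer `x`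
in `G` in inning `n`. -/
theorem LeTwo.of_relation [Nonempty β] {G : SelectionGame α} {H : SelectionGame β}
    (R : ℕ → α → β → Prop)
    (hmove : ∀ n, ∀ B ∈ H.moves, ∃ A ∈ G.moves, ∀ x ∈ A, ∃ y ∈ B, R n x y)
    (htarget : ∀ (x : ℕ → α) (y : ℕ → β), (∀ n, R n (x n) (y n)) →
      range x ∈ G.target → range y ∈ H.target) :
    G.LeTwo H := by
  choose! tI htI tII htII hR using hmove
  refine ⟨?_, ?_, not_imp_not.2 ?_, not_imp_not.2 ?_⟩
  · rintro ⟨τ, hτ⟩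
    refine ⟨fun B n => tII n B (τ (tI n B) n), fun B hB => ?_⟩
    obtain ⟨h₁, h₂⟩ := hτ (fun n => tI n (B n)) fun n => htI n _ (hB n)
    exact ⟨fun n => htII n _ (hB n) _ (h₁ n),
      htarget _ _ (fun n => hR n _ (hB n) _ (h₁ n)) h₂⟩
  · rintro ⟨τ, hτ⟩
    refine ⟨fun l => tII (l.length - 1) (l.getLastD ∅) (τ (l.mapIdx tI)), fun B hB => ?_⟩
    obtain ⟨h₁, h₂⟩ := hτ (fun n => tI n (B n)) fun n => htI n _ (hB n)
    have hmap : ∀ n : ℕ, (List.ofFn fun k : Fin (n + 1) => B k).mapIdx tI =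
        List.ofFn fun k : Fin (n + 1) => tI k (B k) := fun n =>
      List.ext_getElem (by simp) fun i _ _ => by
        simp only [List.getElem_mapIdx, List.getElem_ofFn]
    have hlast : ∀ n : ℕ, (List.ofFn fun k : Fin (n + 1) => B k).getLastD ∅ = B n := fun n => by
      rw [List.ofFn_succ_last]
      simp
    simp only [hmap, hlast, List.length_ofFn, Nat.add_sub_cancel]
    exact ⟨fun n => htII n _ (hB n) _ (h₁ n),
      htarget _ _ (fun n => hR n _ (hB n) _ (h₁ n)) h₂⟩
  · rintro ⟨σ, hσ, hwin⟩
    classical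
    -- `tr` turns a sequence of answers in `G` into the sequence of the corresponding answers
    -- in `H`.
    let tr : List α → List β := fun s => s.foldl (fun l x => l ++ [tII l.length (σ l) x]) []
    have tr_snoc : ∀ s x, tr (s ++ [x]) = tr s ++ [tII (tr s).length (σ (tr s)) x] := fun s x => by
      simp [tr]
    have tr_length : ∀ s, (tr s).length = s.length := fun s => by
      induction s using List.reverseRecOn with
      | nil => rfl
      | append_singleton s x ih => simp [tr_snoc, ih]
    have h0 : σ [] ∈ H.moves := hσ [] (by simp)
    -- Sequences that do not come from a legal play get an arbitrary legal move.
    refine ⟨fun s => if σ (tr s) ∈ H.moves then tI s.length (σ (tr s)) else tI 0 (σ []),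
      fun s _ => ?_, fun x hx => ?_⟩
    · dsimp only
      split_ifs with h
      exacts [htI _ _ h, htI _ _ h0]
    · let y : ℕ → β := fun n => tII n (σ (tr (List.ofFn fun k : Fin n => x k))) (x n)
      have htr : ∀ n, tr (List.ofFn fun k : Fin n => x k) = List.ofFn fun k : Fin n => y k := by
        intro n
        induction n with
        | zero => rfl
        | succ n ih =>
          rw [List.ofFn_succ_last, List.ofFn_succ_last]
          simp only [Fin.val_castSucc, Fin.val_last]
          rw [tr_snoc, tr_length, ih]
          simp [y, ih]
      have hy_eq : ∀ n, y n = tII n (σ (List.ofFn fun k : Fin n => y k)) (x n) := fun n =>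
        congrArg (fun l => tII n (σ l) (x n)) (htr n)
      have hx' : ∀ n, σ (List.ofFn fun k : Fin n => y k) ∈ H.moves →
          x n ∈ tI n (σ (List.ofFn fun k : Fin n => y k)) := fun n hn => by
        have := hx n
        simpa only [htr, if_pos hn, List.length_ofFn] using this
      have hy : ∀ n, σ (List.ofFn fun k : Fin n => y k) ∈ H.moves → y n ∈
          σ (List.ofFn fun k : Fin n => y k) := fun n hn =>
        (hy_eq n).symm ▸ htII n _ hn _ (hx' n hn)
      have hlegal : ∀ n, σ (List.ofFn fun k : Fin n => y k) ∈ H.moves := by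
        intro n
        induction n using Nat.strong_induction_on with
        | _ n ih =>
          refine hσ _ fun z hz => ?_
          obtain ⟨k, rfl⟩ := (List.mem_ofFn' _ _).1 hz
          exact ⟨_, ih k k.2, hy k (ih k k.2)⟩
      refine fun hmem => hwin y (fun n => hy n (hlegal n)) (htarget x y (fun n => ?_) hmem)
      exact (hy_eq n).symm ▸ hR n _ (hlegal n) _ (hx' n (hlegal n))
  · rintro ⟨σ, hσ, hwin⟩
    exact ⟨fun n => tI n (σ n), fun n => htI n _ (hσ n), fun x hx hmem =>
      hwin (fun n => tII n (σ n) (x n)) (fun n => htII n _ (hσ n) _ (hx n))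
        (htarget _ _ (fun n => hR n _ (hσ n) _ (hx n)) hmem)⟩

theorem LeTwo.trans {γ : Type*} {G : SelectionGame α} {H : SelectionGame β} {K : SelectionGame γ}
    (h₁ : G.LeTwo H) (h₂ : H.LeTwo K) : G.LeTwo K :=
  ⟨h₂.1 ∘ h₁.1, h₂.2.1 ∘ h₁.2.1, h₂.2.2.1 ∘ h₁.2.2.1, h₂.2.2.2 ∘ h₁.2.2.2⟩

theorem LeTwo.antisymm {G : SelectionGame α} {H : SelectionGame β}
    (h₁ : G.LeTwo H) (h₂ : H.LeTwo G) : G.Equivalent H :=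
  ⟨⟨h₁.1, h₂.1⟩, ⟨h₁.2.1, h₂.2.1⟩, ⟨h₁.2.2.1, h₂.2.2.1⟩, ⟨h₁.2.2.2, h₂.2.2.2⟩⟩

end SelectionGame

/-! ### Covers -/

section Covers

variable {X : Type*} [TopologicalSpace X] {𝒜 : Set (Set X)}

theorem IsIdealOfClosedSets.union_finite_mem (h : IsIdealOfClosedSets 𝒜) {A F : Set X}
    (hA : A ∈ 𝒜) (hF : F.Finite) : A ∪ F ∈ 𝒜 := by
  induction F, hF using Set.Finite.induction_on with
  | empty => simpa using hA
  | @insert a s _ _ ih =>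
    have : A ∪ insert a s = (A ∪ s) ∪ {a} := by
      rw [union_assoc, union_singleton]
    exact this ▸ h.union_mem _ ih _ (h.singleton_mem a)

/-- Finitely many sets, each missing a point, cannot contain all the members of an ideal that lie
above a given member. -/
theorem IsIdealOfClosedSets.exists_superset_forall_not_subset (h : IsIdealOfClosedSets 𝒜)
    {A : Set X} (hA : A ∈ 𝒜) {S : Set (Set X)} (hS : S.Finite) (huniv : univ ∉ S) :
    ∃ B ∈ 𝒜, A ⊆ B ∧ ∀ U ∈ S, ¬ B ⊆ U := by
  have : Nonempty X := (h.nonempty A hA).to_type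
  have hpt : ∀ U ∈ S, ∃ x, x ∉ U := fun U hU =>
    (ne_univ_iff_exists_notMem U).1 fun h => huniv (h ▸ hU)
  choose! p hp using hpt
  exact ⟨A ∪ p '' S, h.union_finite_mem hA (hS.image p), subset_union_left,
    fun U hU hsub => hp U hU (hsub (Or.inr (mem_image_of_mem p hU)))⟩

theorem IsIdealOfClosedSets.largeIdealCovers_eq (h : IsIdealOfClosedSets 𝒜) :
    largeIdealCovers 𝒜 = idealCovers 𝒜 := by
  refine Subset.antisymm (fun 𝒰 h𝒰 => h𝒰.1) fun 𝒰 h𝒰 => ⟨h𝒰, fun A hA hfin => ?_⟩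
  obtain ⟨B, hB, hAB, hBU⟩ := h.exists_superset_forall_not_subset hA hfin
    fun hu => h𝒰.2.2.2.1 hu.1
  obtain ⟨U, hU, hBsub⟩ := h𝒰.2.2.2.2 B hB
  exact hBU U ⟨hU, hAB.trans hBsub⟩ hBsub

/-- A sequence of proper non-empty open sets fails to enumerate an ideal cover only by failing to
contain some member of the ideal: that the whole space is covered follows from singletons. -/
theorem IsIdealOfClosedSets.range_mem_idealCovers_iff (h : IsIdealOfClosedSets 𝒜) {U : ℕ → Set X}
    (hU : ∀ n, U n ∈ properOpens ‹TopologicalSpace X›) :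
    range U ∈ idealCovers 𝒜 ↔ ∀ A ∈ 𝒜, ∃ n, A ⊆ U n := by
  constructor
  · intro hr A hA
    obtain ⟨_, ⟨n, rfl⟩, hn⟩ := hr.2.2.2.2 A hA
    exact ⟨n, hn⟩
  · intro hA
    refine ⟨?_, ?_, ?_, ?_, fun A hA' => ?_⟩
    · rintro _ ⟨n, rfl⟩
      exact (hU n).1
    · refine eq_univ_of_forall fun x => ?_
      obtain ⟨n, hn⟩ := hA _ (h.singleton_mem x)
      exact ⟨_, ⟨n, rfl⟩, hn rfl⟩
    · rintro ⟨n, hn⟩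
      exact (hU n).2.1.ne_empty hn
    · rintro ⟨n, hn⟩
      exact (hU n).2.2 hn
    · obtain ⟨n, hn⟩ := hA A hA'
      exact ⟨_, ⟨n, rfl⟩, hn⟩

/-- The complement of a point outside `A` is a proper open neighbourhood of `A`. -/
theorem setNhds_nonempty [T1Space X] {A : Set X} (hne : A.Nonempty) (hA : A ≠ univ) :
    (setNhds ‹TopologicalSpace X› A).Nonempty := by
  obtain ⟨x, hx⟩ := (ne_univ_iff_exists_notMem A).1 hA
  have hsub : A ⊆ {x}ᶜ := fun a ha hax => hx (hax ▸ ha)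
  exact ⟨{x}ᶜ, ⟨isOpen_compl_singleton, hne.mono hsub,
    (ne_univ_iff_exists_notMem _).2 ⟨x, by simp⟩⟩, hsub⟩

end Covers

/-! ### Minimal cusco maps below a given one, and gluing -/

section Cusco

variable {X : Type*} [TopologicalSpace X]

/-- The pointwise intersection of a non-empty chain of cusco maps is a cusco map. -/
theorem IsCusco.iInter_of_isChain {Y : Type*} [TopologicalSpace Y] [T2Space Y] [AddCommGroup Y]
    [Module ℝ Y] {c : Set (X → Set Y)} (hne : c.Nonempty) (hc : ∀ Φ ∈ c, IsCusco Φ)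
    (hchain : IsChain (fun Φ Ψ => Ψ ≤ Φ) c) : IsCusco fun x => ⋂ Φ : c, Φ.1 x := by
  have : Nonempty c := hne.to_subtype
  have hdir : ∀ x, Directed (· ⊇ ·) fun Φ : c => Φ.1 x := fun x Φ Ψ => by
    rcases hchain.total Φ.2 Ψ.2 with h | h
    exacts [⟨Ψ, h x, Subset.rfl⟩, ⟨Φ, Subset.rfl, h x⟩]
  refine { upperHemicontinuous := ?_, nonempty := fun x => ?_, isCompact := fun x => ?_,
           convex := fun x => convex_iInter fun Φ => (hc Φ Φ.2).convex x }
  · refine upperHemicontinuous_iff_forall_isOpen.2 fun x u hu hxu => ?_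
    obtain ⟨Φ, hΦ⟩ := exists_subset_nhds_of_isCompact (hdir x)
      (fun Φ => (hc Φ Φ.2).isCompact x) fun y hy => hu.mem_nhds (hxu hy)
    exact ((hc Φ Φ.2).upperHemicontinuous.forall_isOpen x u hu hΦ).mono
      fun z hz => (iInter_subset _ Φ).trans hz
  · exact IsCompact.nonempty_iInter_of_directed_nonempty_isCompact_isClosed _ (hdir x)
      (fun Φ => (hc Φ Φ.2).nonempty x) (fun Φ => (hc Φ Φ.2).isCompact x)
      fun Φ => ((hc Φ Φ.2).isCompact x).isClosed
  · obtain ⟨Φ⟩ := this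
    exact ((hc Φ Φ.2).isCompact x).of_isClosed_subset
      (isClosed_iInter fun Ψ => ((hc Ψ Ψ.2).isCompact x).isClosed) (iInter_subset _ Φ)

theorem IsCusco.exists_minimal_le {Y : Type*} [TopologicalSpace Y] [T2Space Y] [AddCommGroup Y]
    [Module ℝ Y] {Θ : X → Set Y} (hΘ : IsCusco Θ) :
    ∃ Φ ≤ Θ, Minimal (fun Ψ : X → Set Y => IsCusco Ψ) Φ :=
  zorn_le_nonempty₀ (α := (X → Set Y)ᵒᵈ) {Ψ | IsCusco (OrderDual.ofDual Ψ)}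
    (fun c hcs hchain Ψ hΨ => ⟨OrderDual.toDual fun x => ⋂ Φ : c, OrderDual.ofDual Φ.1 x,
      IsCusco.iInter_of_isChain ⟨Ψ, hΨ⟩ hcs hchain, fun Φ hΦ _ => iInter_subset _ (⟨Φ, hΦ⟩ : c)⟩)
    (OrderDual.toDual Θ) hΘ

variable {E : Type*} [NormedAddCommGroup E] [NormedSpace ℝ E]

theorem IsCompact.convexJoin_singleton {s : Set E} (hs : IsCompact s) (c : E) :
    IsCompact (convexJoin ℝ {c} s) := by
  have : convexJoin ℝ {c} s =
      (fun p : ℝ × E => (1 - p.1) • c + p.1 • p.2) '' (Icc (0 : ℝ) 1 ×ˢ s) := by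
    ext z
    simp only [convexJoin_singleton_left, segment_eq_image, mem_iUnion, mem_image, mem_prod,
      Prod.exists, exists_prop]
    constructor
    · rintro ⟨y, hy, t, ht, rfl⟩
      exact ⟨t, y, ⟨ht, hy⟩, rfl⟩
    · rintro ⟨t, y, ⟨ht, hy⟩, rfl⟩
      exact ⟨y, hy, t, ht, rfl⟩
  rw [this]
  exact (isCompact_Icc.prod hs).image (by fun_prop)

open Classical in
/-- The map that is `Φ` on the open set `V` and `{c}` off the closure of `V`, and whose value at a
boundary point `x` of `V` is the convex hull of `Φ x ∪ {c}`. -/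
def glueConst (Φ : X → Set E) (V : Set X) (c : E) (x : X) : Set E :=
  if x ∈ V then Φ x else if x ∈ closure V then convexJoin ℝ {c} (Φ x) else {c}

theorem glueConst_of_mem {Φ : X → Set E} {V : Set X} {c : E} {x : X} (hx : x ∈ V) :
    glueConst Φ V c x = Φ x := if_pos hx

theorem glueConst_of_notMem_closure {Φ : X → Set E} {V : Set X} {c : E} {x : X}
    (hx : x ∉ closure V) : glueConst Φ V c x = {c} := by
  rw [glueConst, if_neg fun h => hx (subset_closure h), if_neg hx]

theorem glueConst_of_mem_frontier {Φ : X → Set E} {V : Set X} {c : E} {x : X}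
    (hx : x ∈ closure V) (hx' : x ∉ V) : glueConst Φ V c x = convexJoin ℝ {c} (Φ x) := by
  rw [glueConst, if_neg hx', if_pos hx]

theorem IsCusco.glueConst {Φ : X → Set E} (hΦ : IsCusco Φ) {V : Set X} (hV : IsOpen V) (c : E) :
    IsCusco (glueConst Φ V c) := by
  -- Everything but upper semicontinuity is checked on the three regions separately.
  have cases : ∀ P : Set E → Prop, ∀ x, P (Φ x) → P (convexJoin ℝ {c} (Φ x)) → P {c} →
      P (_root_.glueConst Φ V c x) := fun P x h₁ h₂ h₃ => by
    unfold _root_.glueConst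
    split_ifs <;> assumption
  refine { upperHemicontinuous := ?_, nonempty := fun x => ?_, isCompact := fun x => ?_,
           convex := fun x => ?_ }
  · refine upperHemicontinuous_iff_forall_isOpen.2 fun x u hu hxu => ?_
    by_cases hxV : x ∈ V
    · rw [glueConst_of_mem hxV] at hxu
      filter_upwards [hV.mem_nhds hxV, hΦ.upperHemicontinuous.forall_isOpen x u hu hxu]
        with z hzV hz
      rwa [glueConst_of_mem hzV]
    by_cases hxc : x ∈ closure V
    · rw [glueConst_of_mem_frontier hxc hxV] at hxu
      -- A convex neighbourhood of the compact convex hull, inside `u`, also contains the hulls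
      -- at nearby points.
      have hconv : Convex ℝ (convexJoin ℝ {c} (Φ x)) :=
        (convex_singleton c).convexJoin (hΦ.convex x)
      obtain ⟨δ, hδ, hsub⟩ :=
        ((hΦ.isCompact x).convexJoin_singleton c).exists_thickening_subset_open hu hxu
      have hself := Metric.self_subset_thickening hδ (convexJoin ℝ {c} (Φ x))
      have hcδ : {c} ⊆ Metric.thickening δ (convexJoin ℝ {c} (Φ x)) :=
        (subset_convexJoin_left (hΦ.nonempty x)).trans hself
      filter_upwards [hΦ.upperHemicontinuous.forall_isOpen x _ Metric.isOpen_thickening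
        ((subset_convexJoin_right (singleton_nonempty c)).trans hself)] with z hz
      exact (cases (· ⊆ Metric.thickening δ (convexJoin ℝ {c} (Φ x))) z hz
        (convexJoin_subset hcδ hz (hconv.thickening δ)) hcδ).trans hsub
    · rw [glueConst_of_notMem_closure hxc] at hxu
      filter_upwards [isClosed_closure.isOpen_compl.mem_nhds hxc] with z hz
      rwa [glueConst_of_notMem_closure hz]
  · exact cases Set.Nonempty x (hΦ.nonempty x)
      ((hΦ.nonempty x).mono (subset_convexJoin_right (singleton_nonempty c)))
      (singleton_nonempty c)
  · exact cases IsCompact x (hΦ.isCompact x) ((hΦ.isCompact x).convexJoin_singleton c)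
      isCompact_singleton
  · exact cases (Convex ℝ) x (hΦ.convex x) ((convex_singleton c).convexJoin (hΦ.convex x))
      (convex_singleton c)

open Classical in
/-- A cusco map that lies below a minimal cusco map on an open set agrees with it there. -/
theorem eqOn_of_minimal_isCusco {Y : Type*} [TopologicalSpace Y] [AddCommGroup Y] [Module ℝ Y]
    {Φ Ψ : X → Set Y} (hΦ : Minimal (fun Ψ : X → Set Y => IsCusco Ψ) Φ) (hΨ : IsCusco Ψ)
    {V : Set X} (hV : IsOpen V) (hle : ∀ x ∈ V, Ψ x ⊆ Φ x) : EqOn Ψ Φ V := by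
  -- Replacing `Φ` by `Ψ` on `V` gives a cusco map below `Φ`.
  have hmix_le : V.piecewise Ψ Φ ≤ Φ := fun x => by
    by_cases hx : x ∈ V
    · rw [piecewise_eq_of_mem _ _ _ hx]
      exact hle x hx
    · rw [piecewise_eq_of_notMem _ _ _ hx]
  have hmix : IsCusco (V.piecewise Ψ Φ) := by
    have cases : ∀ P : Set Y → Prop, ∀ x, P (Ψ x) → P (Φ x) → P (V.piecewise Ψ Φ x) :=
      fun P x h₁ h₂ => by
        unfold Set.piecewise
        split_ifs <;> assumption
    have hΦc : IsCusco Φ := hΦ.prop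
    refine { upperHemicontinuous := ?_
             nonempty := fun x => cases Set.Nonempty x (hΨ.nonempty x) (hΦc.nonempty x)
             isCompact := fun x => cases IsCompact x (hΨ.isCompact x) (hΦc.isCompact x)
             convex := fun x => cases (Convex ℝ) x (hΨ.convex x) (hΦc.convex x) }
    refine upperHemicontinuous_iff_forall_isOpen.2 fun x u hu hxu => ?_
    by_cases hx : x ∈ V
    · rw [piecewise_eq_of_mem _ _ _ hx] at hxu
      filter_upwards [hV.mem_nhds hx, hΨ.upperHemicontinuous.forall_isOpen x u hu hxu]
        with z hzV hz
      rwa [piecewise_eq_of_mem _ _ _ hzV]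
    · rw [piecewise_eq_of_notMem _ _ _ hx] at hxu
      exact (hΦc.upperHemicontinuous.forall_isOpen x u hu hxu).mono
        fun z hz => (hmix_le z).trans hz
  intro x hx
  refine (hle x hx).antisymm ?_
  have := hΦ.le_of_le hmix hmix_le x
  rwa [piecewise_eq_of_mem _ _ _ hx] at this

end Cusco

namespace MC

variable {X : Type*} [TopologicalSpace X]

theorem isCusco (Φ : MC X) : IsCusco Φ.1 := Φ.2.prop

/-- In an `𝒜`-normal space a minimal cusco map can be changed to a prescribed constant off any
neighbourhood `U` of a member `A` of `𝒜` without being changed on `A`. -/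
theorem exists_eqOn_eqOn_compl {𝒜 : Set (Set X)} (hnormal : IdealNormal 𝒜) (Φ : MC X)
    {A U : Set X} (hA : A ∈ 𝒜) (hU : IsOpen U) (hAU : A ⊆ U) (c : ℝ) :
    ∃ Ψ : MC X, EqOn Ψ.1 Φ.1 A ∧ ∀ x ∉ U, Ψ.1 x = {c} := by
  obtain ⟨V, hV, hAV, hVU⟩ := hnormal A hA U hU hAU
  obtain ⟨Ψ, hle, hΨ⟩ := (Φ.isCusco.glueConst hV c).exists_minimal_le
  have hΨc : IsCusco Ψ := hΨ.prop
  refine ⟨⟨Ψ, hΨ⟩, (eqOn_of_minimal_isCusco Φ.2 hΨc hV fun x hx => ?_).mono hAV,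
    fun x hx => ?_⟩
  · exact (hle x).trans_eq (glueConst_of_mem hx)
  · have := hle x
    rw [glueConst_of_notMem_closure fun h => hx (hVU h)] at this
    exact (hΨc.nonempty x).subset_singleton_iff.1 this

instance : Nonempty (MC X) := ⟨zero⟩

/-! ### The topology of uniform convergence on an ideal -/

theorem mem_W_of_eqOn {Φ Ψ : MC X} {A : Set X} (h : EqOn Ψ.1 Φ.1 A) {ε : ℝ} (hε : 0 < ε) :
    (Φ, Ψ) ∈ W A ε := fun x hx => by
  rw [h hx]
  exact ⟨Metric.self_subset_thickening hε _, Metric.self_subset_thickening hε _⟩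

theorem setOf_mem_W_mem_nhds {𝒜 : Set (Set X)} {A : Set X} (hA : A ∈ 𝒜) {ε : ℝ} (hε : 0 < ε)
    (Φ : MC X) : {Ψ | (Φ, Ψ) ∈ W A ε} ∈ @nhds _ (topology 𝒜) Φ := by
  rw [(uniformCore 𝒜).nhds_toTopologicalSpace]
  exact preimage_mem_comap (mem_iInf_of_mem A <| mem_iInf_of_mem hA <| mem_iInf_of_mem ε <|
    mem_iInf_of_mem hε <| mem_principal_self _)

/-- Without points there is only one minimal cusco map, hence no proper non-empty open set. -/
theorem nonempty_of_mem_properOpens {𝒜 : Set (Set X)} {S : Set (MC X)}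
    (hS : S ∈ properOpens (topology 𝒜)) : Nonempty X := by
  by_contra h
  rw [not_nonempty_iff] at h
  obtain ⟨Φ, hΦ⟩ := hS.2.1
  exact hS.2.2 (eq_univ_of_forall fun Ψ =>
    (Subtype.ext (funext fun x => isEmptyElim x) : Φ = Ψ) ▸ hΦ)

theorem zero_mem_W_iff {Φ : MC X} {A : Set X} {ε : ℝ} :
    (zero, Φ) ∈ W A ε ↔ ∀ x ∈ A, Φ.1 x ⊆ Metric.ball 0 ε := by
  refine forall₂_congr fun x _ => ⟨fun h => ?_, fun h => ⟨?_, ?_⟩⟩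
  · simpa only [zero, Metric.thickening_singleton] using h.2
  · obtain ⟨y, hy⟩ := Φ.isCusco.nonempty x
    refine singleton_subset_iff.2 (Metric.mem_thickening_iff.2 ⟨y, hy, ?_⟩)
    rw [dist_comm]
    exact h hy
  · simpa only [zero, Metric.thickening_singleton] using h

theorem t1Space_topology {𝒜 : Set (Set X)} (h𝒜 : IsIdealOfClosedSets 𝒜) :
    @T1Space (MC X) (topology 𝒜) := by
  let _ := topology 𝒜
  refine ⟨fun Φ => ⟨isOpen_iff_mem_nhds.2 fun Ψ hne => ?_⟩⟩
  by_contra hmem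
  refine hne (Subtype.ext (funext fun x => ?_) : Ψ = Φ)
  have hW : ∀ ε > 0, (Ψ, Φ) ∈ W {x} ε := fun ε hε => by
    by_contra hnot
    refine hmem (mem_of_superset (setOf_mem_W_mem_nhds (h𝒜.singleton_mem x) hε Ψ) ?_)
    rintro Θ hΘ (rfl : Θ = Φ)
    exact hnot hΘ
  have hsub : ∀ {S T : Set ℝ}, IsCompact T → (∀ ε > 0, S ⊆ Metric.thickening ε T) → S ⊆ T :=
    fun {S T} hT h => by
      rw [← hT.isClosed.closure_eq, Metric.closure_eq_iInter_thickening]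
      exact subset_iInter₂ h
  exact (hsub (Φ.isCusco.isCompact x) fun ε hε => (hW ε hε x rfl).1).antisymm
    (hsub (Ψ.isCusco.isCompact x) fun ε hε => (hW ε hε x rfl).2)

theorem zero_mem_closure_iff [Nonempty X] {𝒜 : Set (Set X)} (h𝒜 : IsIdealOfClosedSets 𝒜)
    {S : Set (MC X)} :
    S ∈ clusterSets (topology 𝒜) zero ↔
      ∀ A ∈ 𝒜, ∀ ε > 0, ∃ Φ ∈ S, ∀ x ∈ A, Φ.1 x ⊆ Metric.ball 0 ε := by
  let _ := topology 𝒜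
  constructor
  · intro h A hA ε hε
    obtain ⟨Φ, hΦ, hΦS⟩ := mem_closure_iff_nhds.1 h _ (setOf_mem_W_mem_nhds hA hε zero)
    exact ⟨Φ, hΦS, zero_mem_W_iff.1 hΦ⟩
  · intro h
    by_contra hnot
    obtain ⟨A, hA, ε, hε, hsub⟩ := (isOpen_topology_iff h𝒜 _).1
      (isClosed_closure (s := S)).isOpen_compl zero hnot
    obtain ⟨Φ, hΦS, hΦ⟩ := h A hA ε hε
    exact hsub (zero_mem_W_iff.2 hΦ) (subset_closure hΦS)

/-- Minimal cusco maps are locally bounded, hence bounded on sequentially compact sets. -/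
theorem exists_forall_subset_ball {B : Set X} (hB : IsSeqCompact B) (Φ : MC X) :
    ∃ M : ℕ, ∀ x ∈ B, Φ.1 x ⊆ Metric.ball 0 M := by
  by_contra! h
  choose x hxB hx using h
  obtain ⟨a, -, φ, hφ, hlim⟩ := hB hxB
  obtain ⟨r, hr⟩ := (Φ.isCusco.isCompact a).isBounded.subset_ball 0
  have hev := hlim.eventually (Φ.isCusco.upperHemicontinuous.forall_isOpen a _ Metric.isOpen_ball hr)
  obtain ⟨n, hn, hrn⟩ := (hev.and ((tendsto_natCast_atTop_atTop.comp
    hφ.tendsto_atTop).eventually_ge_atTop r)).exists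
  exact hx (φ n) (hn.trans (Metric.ball_subset_ball hrn))

/-- A sequence of maps whose `n`-th member takes the value `{n + 1}` somewhere on a sequentially
compact member of the ideal is locally finite: near a given map only the numbers below a bound of
that map occur. -/
theorem range_mem_closedDiscreteSets {ℬ : Set (Set X)} (hℬ : IsIdealOfClosedSets ℬ) {B : Set X}
    (hB : B ∈ ℬ) (hseq : IsSeqCompact B) {Φ : ℕ → MC X}
    (hΦ : ∀ n, ∃ x ∈ B, (Φ n).1 x = {(n : ℝ) + 1}) :
    range Φ ∈ closedDiscreteSets (topology ℬ) := by
  let _ := topology ℬ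
  have := t1Space_topology hℬ
  refine isClosed_and_discrete_iff.2 fun Ψ => ?_
  obtain ⟨M, hM⟩ := exists_forall_subset_ball hseq Ψ
  have hfin : {n | (Ψ, Φ n) ∈ W B 1}.Finite := by
    refine (finite_Iio M).subset fun n hn => ?_
    obtain ⟨x, hx, hval⟩ := hΦ n
    have hmem := (hn x hx).2
    rw [hval, singleton_subset_iff, Metric.mem_thickening_iff] at hmem
    obtain ⟨y, hy, hdist⟩ := hmem
    have hy' := hM x hx hy
    rw [Metric.mem_ball, Real.dist_eq, abs_lt] at hy'
    rw [Real.dist_eq, abs_lt] at hdist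
    have : (n : ℝ) < M := by linarith [hy'.2, hdist.2]
    exact_mod_cast this
  rw [disjoint_principal_right, mem_nhdsWithin_iff_exists_mem_nhds_inter]
  refine ⟨_, inter_mem (setOf_mem_W_mem_nhds hB one_pos Ψ)
    (((hfin.image Φ).subset (sdiff_subset (t := {Ψ}))).isClosed.isOpen_compl.mem_nhds
      fun h => h.2 rfl), ?_⟩
  rintro _ ⟨⟨h₁, h₂⟩, hne⟩ ⟨n, rfl⟩
  exact h₂ ⟨⟨n, h₁, rfl⟩, hne⟩

end MC

/-! ### Comparison of the games -/

section Games

variable {X : Type*} [tX : TopologicalSpace X] {𝒜 ℬ : Set (Set X)}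

open SelectionGame

/-- A move `S` of One in the game on `MC_𝒜(X)` contains some `[Φ; A, ε]`, and One plays the
neighbourhoods of `A` in the covering game. In inning `n`, an answer `U` yields a member of
`[Φ; A, ε]` that is constantly `n + 1` off `U`. If some `B ∈ ℬ` is contained in none of the
answers, then each of these maps takes its large value on `B`. -/
theorem coverGame_leTwo_properOpens [T1Space X] (h𝒜 : IsIdealOfClosedSets 𝒜)
    (hℬ : IsIdealOfClosedSets ℬ) (hnormal : IdealNormal 𝒜) {target : Set (Set (MC X))}
    (htarget : ∀ B ∈ ℬ, ∀ Φ : ℕ → MC X, (∀ n, ∃ x ∈ B, (Φ n).1 x = {(n : ℝ) + 1}) →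
      range Φ ∈ target) :
    (G₁ (nhdFamilies tX 𝒜) (idealCovers ℬ)ᶜ).LeTwo (G₁ (properOpens (MC.topology 𝒜)) target) := by
  refine LeTwo.of_relation
    (fun n U Φ => U ∈ properOpens tX ∧ ∀ x ∉ U, Φ.1 x = {(n : ℝ) + 1}) (fun n S hS => ?_)
    fun U Φ hR hU => ?_
  · have := MC.nonempty_of_mem_properOpens hS
    obtain ⟨Φ, hΦ⟩ := hS.2.1
    obtain ⟨A, hA, ε, hε, hsub⟩ := (MC.isOpen_topology_iff h𝒜 S).1 hS.1 Φ hΦ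
    refine ⟨setNhds tX A, mem_image_of_mem _ hA, fun U hU => ?_⟩
    obtain ⟨Ψ, hΨA, hΨU⟩ := MC.exists_eqOn_eqOn_compl hnormal Φ hA hU.1.1 hU.2 ((n : ℝ) + 1)
    exact ⟨Ψ, hsub (MC.mem_W_of_eqOn hΨA hε), hU.1, hΨU⟩
  · have hU' : range U ∉ idealCovers ℬ := hU
    rw [hℬ.range_mem_idealCovers_iff fun n => (hR n).1] at hU'
    push Not at hU'
    obtain ⟨B, hB, hBU⟩ := hU'
    refine htarget B hB Φ fun n => ?_
    obtain ⟨x, hx, hxU⟩ := not_subset.1 (hBU n)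
    exact ⟨x, hx, (hR n).2 x hxU⟩

theorem properOpens_leTwo_properNhds {Y : Type*} (t : TopologicalSpace Y) (y : Y)
    (target : Set (Set Y)) :
    (G₁ (properOpens t) target).LeTwo (G₁ (properNhds t y) target) := by
  have : Nonempty Y := ⟨y⟩
  refine LeTwo.of_relation (fun _ x z => z = x) (fun _ S hS => ⟨S, hS.1, fun x hx => ⟨x, hx, rfl⟩⟩)
    fun x z hR hx => ?_
  rwa [(funext hR : z = x)]

/-- One removes the point `0` from each neighbourhood of it, so that a closed set of answers cannot
have `0` in its closure. -/
theorem closedDiscrete_leTwo_properNhds [T1Space X] (h𝒜 : IsIdealOfClosedSets 𝒜)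
    (h𝒜_univ : univ ∉ 𝒜) (hnormal : IdealNormal 𝒜) :
    (G₁ (properOpens (MC.topology 𝒜)) (closedDiscreteSets (MC.topology ℬ))).LeTwo
      (G₁ (properNhds (MC.topology 𝒜) MC.zero) (clusterSets (MC.topology ℬ) MC.zero)ᶜ) := by
  refine LeTwo.of_relation (fun _ Φ Ψ => Ψ = Φ ∧ Φ ≠ MC.zero) (fun _ S hS => ?_)
    fun Φ Ψ hR hΦ => ?_
  · have := MC.nonempty_of_mem_properOpens hS.1
    refine ⟨S \ {MC.zero}, ⟨?_, ?_, ?_⟩, fun Φ hΦ => ⟨Φ, hΦ.1, rfl, hΦ.2⟩⟩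
    · let _ := MC.topology 𝒜
      have := MC.t1Space_topology h𝒜
      exact IsOpen.sdiff hS.1.1 isClosed_singleton
    · -- No neighbourhood of `0` is a singleton: it contains a map that takes the value `{1}`.
      obtain ⟨A, hA, ε, hε, hsub⟩ := (MC.isOpen_topology_iff h𝒜 S).1 hS.1.1 _ hS.2
      obtain ⟨U, hU⟩ := setNhds_nonempty (h𝒜.nonempty A hA) fun h => h𝒜_univ (h ▸ hA)
      obtain ⟨Ψ, hΨA, hΨU⟩ := MC.exists_eqOn_eqOn_compl hnormal MC.zero hA hU.1.1 hU.2 1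
      refine ⟨Ψ, hsub (MC.mem_W_of_eqOn hΨA hε), fun h => ?_⟩
      obtain ⟨x, hx⟩ := (ne_univ_iff_exists_notMem U).1 hU.1.2.2
      have h01 : MC.zero.1 x = {(1 : ℝ)} := (mem_singleton_iff.1 h) ▸ hΨU x hx
      exact zero_ne_one (singleton_injective h01)
    · exact fun h => (h.symm ▸ mem_univ MC.zero : MC.zero ∈ S \ {MC.zero}).2 rfl
  · obtain rfl : Ψ = Φ := funext fun n => (hR n).1
    rintro (hmem : _ ∈ @closure _ (MC.topology ℬ) _)
    rw [@IsClosed.closure_eq _ (MC.topology ℬ) _ hΦ.1] at hmem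
    obtain ⟨n, hn⟩ := hmem
    exact (hR n).2 hn

/-- When One plays the neighbourhoods of `A` in inning `n` of the covering game, the interior of
`[0; A, 1 / (n + 1)]` is played on `MC_𝒜(X)`, and an answer `Φ` yields the set of all `x` with
`Φ x` in the ball of radius `1 / (n + 1)`. This set may fail to be proper; it is then replaced by
an arbitrary answer. If the maps do not accumulate at `0`, as seen on `B ∈ ℬ`, then this happens in
finitely many innings only, and adding finitely many points to `B` gives a member of `ℬ` that is
contained in none of the sets. -/
theorem properNhds_leTwo_coverGame [T1Space X] (h𝒜 : IsIdealOfClosedSets 𝒜)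
    (h𝒜_univ : univ ∉ 𝒜) (hℬ : IsIdealOfClosedSets ℬ) (hnormal : IdealNormal 𝒜) :
    (G₁ (properNhds (MC.topology 𝒜) MC.zero) (clusterSets (MC.topology ℬ) MC.zero)ᶜ).LeTwo
      (G₁ (nhdFamilies tX 𝒜) (idealCovers ℬ)ᶜ) := by
  refine LeTwo.of_relation
    (fun n Φ U => U ∈ properOpens tX ∧
      ((∀ x, Φ.1 x ⊆ Metric.ball 0 (1 / ((n : ℝ) + 1))) ∨
        ∀ x ∈ U, Φ.1 x ⊆ Metric.ball 0 (1 / ((n : ℝ) + 1))))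
    (fun n 𝒩 h𝒩 => ?_) fun Φ U hR hΦ => ?_
  · obtain ⟨A, hA, rfl⟩ := h𝒩
    have hpos : 0 < 1 / ((n : ℝ) + 1) := Nat.one_div_pos_of_nat
    obtain ⟨U₀, hU₀⟩ := setNhds_nonempty (h𝒜.nonempty A hA) fun h => h𝒜_univ (h ▸ hA)
    let _ := MC.topology 𝒜
    have h0 : MC.zero ∈ interior {Ψ | (MC.zero, Ψ) ∈ MC.W A (1 / ((n : ℝ) + 1))} :=
      mem_interior_iff_mem_nhds.2 (MC.setOf_mem_W_mem_nhds hA hpos _)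
    have hsmall_on : ∀ Φ ∈ interior {Ψ | (MC.zero, Ψ) ∈ MC.W A (1 / ((n : ℝ) + 1))}, ∀ x ∈ A,
        Φ.1 x ⊆ Metric.ball 0 (1 / ((n : ℝ) + 1)) := fun Φ hΦ =>
      MC.zero_mem_W_iff.1 (interior_subset (s := {Ψ | (MC.zero, Ψ) ∈ MC.W A _}) hΦ)
    refine ⟨_, ⟨⟨isOpen_interior, ⟨_, h0⟩, fun huniv => ?_⟩, h0⟩, fun Φ hΦ => ?_⟩
    · -- A map with the value `{1}` at a point of `A` is not in the neighbourhood.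
      obtain ⟨a, ha⟩ := h𝒜.nonempty A hA
      obtain ⟨x, hx⟩ := (ne_univ_iff_exists_notMem A).1 fun h => h𝒜_univ (h ▸ hA)
      obtain ⟨Ψ, -, hΨ⟩ := MC.exists_eqOn_eqOn_compl hnormal MC.zero (h𝒜.singleton_mem x)
        (isOpen_compl_singleton (x := a)) (by rintro _ rfl rfl; exact hx ha) 1
      have hmem := hsmall_on Ψ (huniv.symm ▸ mem_univ Ψ) a ha
      rw [hΨ a (by simp), singleton_subset_iff, Metric.mem_ball, dist_zero_right, norm_one] at hmem
      have : 1 / ((n : ℝ) + 1) ≤ 1 := by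
        rw [div_le_one (by positivity)]
        linarith [n.cast_nonneg (α := ℝ)]
      linarith
    · by_cases hsmall : ∀ x, Φ.1 x ⊆ Metric.ball 0 (1 / ((n : ℝ) + 1))
      · exact ⟨U₀, hU₀, hU₀.1, Or.inl hsmall⟩
      · have hAU := hsmall_on Φ hΦ
        have hprop : {x | Φ.1 x ⊆ Metric.ball 0 (1 / ((n : ℝ) + 1))} ∈ properOpens tX :=
          ⟨(upperHemicontinuous_iff_isOpen_setOf_subset _).1 Φ.isCusco.upperHemicontinuous _
            Metric.isOpen_ball, (h𝒜.nonempty A hA).mono hAU,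
            fun h => hsmall fun x => eq_univ_iff_forall.1 h x⟩
        exact ⟨_, ⟨hprop, hAU⟩, hprop, Or.inr fun x hx => hx⟩
  · have : Nonempty X := (hR 0).1.2.1.to_type
    have hΦ' : range Φ ∉ clusterSets (MC.topology ℬ) MC.zero := hΦ
    rw [MC.zero_mem_closure_iff hℬ] at hΦ'
    push Not at hΦ'
    obtain ⟨B, hB, ε, hε, hfar⟩ := hΦ'
    obtain ⟨N, hN⟩ := exists_nat_one_div_lt hε
    obtain ⟨B', hB', hBB', hsub⟩ := hℬ.exists_superset_forall_not_subset hB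
      ((finite_Iio N).image U) (by rintro ⟨n, -, hn⟩; exact (hR n).1.2.2 hn)
    refine fun hcov => ?_
    obtain ⟨n, hn⟩ := (hℬ.range_mem_idealCovers_iff fun n => (hR n).1).1 hcov B' hB'
    rcases lt_or_ge n N with hnN | hnN
    · exact hsub _ (mem_image_of_mem U hnN) hn
    · have hball : Metric.ball (0 : ℝ) (1 / ((n : ℝ) + 1)) ⊆ Metric.ball 0 ε :=
        Metric.ball_subset_ball ((Nat.one_div_le_one_div hnN).trans hN.le)
      obtain ⟨x, hx, hxfar⟩ := hfar _ (mem_range_self n)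
      rcases (hR n).2 with h | h
      · exact hxfar ((h x).trans hball)
      · exact hxfar ((h x (hn (hBB' hx))).trans hball)

end Games

theorem mainTheorem3 {X : Type*} [tX : TopologicalSpace X] [T2Space X]
    (𝒜 ℬ : Set (Set X)) (h𝒜 : IsIdealOfClosedSets 𝒜) (hℬ : IsIdealOfClosedSets ℬ)
    (h𝒜_univ : univ ∉ 𝒜) (hℬ_univ : univ ∉ ℬ)
    (hnormal : IdealNormal 𝒜) (hseq : ∀ B ∈ ℬ, IsSeqCompact B) :
    (G₁ (nhdFamilies tX 𝒜) (largeIdealCovers ℬ)ᶜ).LeTwo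
        (G₁ (properOpens (MC.topology 𝒜)) (closedDiscreteSets (MC.topology ℬ))) ∧
      (G₁ (nhdFamilies tX 𝒜) (idealCovers ℬ)ᶜ).Equivalent
        (G₁ (properNhds (MC.topology 𝒜) MC.zero) (clusterSets (MC.topology ℬ) MC.zero)ᶜ) ∧
      (G₁ (properNhds (MC.topology 𝒜) MC.zero) (clusterSets (MC.topology ℬ) MC.zero)ᶜ).Equivalent
        (G₁ (properOpens (MC.topology 𝒜)) (clusterSets (MC.topology ℬ) MC.zero)ᶜ) ∧
      (G₁ (properOpens (MC.topology 𝒜)) (clusterSets (MC.topology ℬ) MC.zero)ᶜ).Equivalent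
        (G₁ (properOpens (MC.topology 𝒜)) (closedDiscreteSets (MC.topology ℬ))) := by
  have hcover_cluster : (G₁ (nhdFamilies tX 𝒜) (idealCovers ℬ)ᶜ).LeTwo
      (G₁ (properOpens (MC.topology 𝒜)) (clusterSets (MC.topology ℬ) MC.zero)ᶜ) := by
    refine coverGame_leTwo_properOpens h𝒜 hℬ hnormal fun B hB Φ hΦ hmem => ?_
    have : Nonempty X := (hℬ.nonempty B hB).to_type
    obtain ⟨_, ⟨n, rfl⟩, hn⟩ := (MC.zero_mem_closure_iff hℬ).1 hmem B hB 1 one_pos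
    obtain ⟨x, hx, hval⟩ := hΦ n
    have hlt := hn x hx
    rw [hval, singleton_subset_iff, Metric.mem_ball, dist_zero_right, Real.norm_eq_abs] at hlt
    linarith [le_abs_self ((n : ℝ) + 1), n.cast_nonneg (α := ℝ)]
  have hcover_discrete : (G₁ (nhdFamilies tX 𝒜) (idealCovers ℬ)ᶜ).LeTwo
      (G₁ (properOpens (MC.topology 𝒜)) (closedDiscreteSets (MC.topology ℬ))) :=
    coverGame_leTwo_properOpens h𝒜 hℬ hnormal fun B hB Φ hΦ =>
      MC.range_mem_closedDiscreteSets hℬ hB (hseq B hB) hΦ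
  have hcluster_nhds := properOpens_leTwo_properNhds (MC.topology 𝒜) MC.zero
    (clusterSets (MC.topology ℬ) MC.zero)ᶜ
  have hdiscrete_nhds := closedDiscrete_leTwo_properNhds (ℬ := ℬ) h𝒜 h𝒜_univ hnormal
  have hnhds_cover := properNhds_leTwo_coverGame h𝒜 h𝒜_univ hℬ hnormal
  refine ⟨hℬ.largeIdealCovers_eq ▸ hcover_discrete, ?_, ?_, ?_⟩
  · exact (hcover_cluster.trans hcluster_nhds).antisymm hnhds_cover
  · exact (hnhds_cover.trans hcover_cluster).antisymm hcluster_nhds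
  · exact ((hcluster_nhds.trans hnhds_cover).trans hcover_discrete).antisymm
      ((hdiscrete_nhds.trans hnhds_cover).trans hcover_cluster)
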